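/- Let $p$ be a prime and let $R=\bigoplus_{n\in\mathbb{Z}_{\ge 0}}R_n$ be a finitely generated graded commutative algebra over a field $R_0=\mathbb{K}$ of characteristic $p$. For $e\ge 0$ let $F^e_*R$ be the abelian group $R$ with the $R$-module structure $g\cdot F^e_*f=F^e_*(g^{p^e}f)$, graded by $\deg(F^e_*r)=\frac{1}{p^e}\deg(r)$. For a $\mathbb{Q}$-graded module $M$ and $\theta\in\mathbb{Q}$ write $M(\theta)_q=M_{q+\theta}$. Suppose that $R$ has finite $F$-representation type: there are finitely many finitely generated ($\mathbb{Q}$-)graded $R$-modules $M_1,\dots,M_\ell$ such that for every $e\ge 0$ there are $\alpha_{e,i}\in\mathbb{Z}_{\ge 0}$ and $\theta^{(e)}_{i,j}\in\mathbb{Q}_{\le 0}$ and an isomorphism of graded modules $$F^e_*R\cong\bigoplus_{i=1}^{\ell}\bigoplus_{j=1}^{\alpha_{e,i}}M_i(\theta^{(e)}_{i,j}).$$ Let $\mathfrak{a}\subseteq R$ be an ideal (not necessarily homogeneous). For an ideal $\mathfrak{b}$ with $\mathfrak{a}\subseteq\sqrt{\mathfrak{b}}\ne(1)$ consider the $F$-threshold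 $$c^{\mathfrak{b}}(\mathfrak{a})=\lim_{e\to\infty}\frac{\max\{n\in\mathbb{Z}_{\ge 0} : \mathfrak{a}^n\not\subseteq\mathfrak{b}^{[p^e]}\}}{p^e},$$ where $\mathfrak{b}^{[p^e]}$ is the ideal generated by all $f^{p^e}$ with $f\in\mathfrak{b}$, and, if $R$ is $F$-split (that is, if some $\varphi\in\operatorname{Hom}_R(F^1_*R,R)$ has $\varphi(F^1_*1)=1$), the Cartier threshold $$\operatorname{ct}^{\mathfrak{b}}(\mathfrak{a})=\lim_{e\to\infty}\frac{\max\{n\in\mathbb{Z}_{\ge 0} : \mathcal{C}^e_R\cdot\mathfrak{a}^n\not\subseteq\mathfrak{b}\}}{p^e},$$ where $\mathcal{C}^e_R\cdot\mathfrak{c}$ is the ideal generated by all $\varphi(F^e_*f)$ with $\varphi\in\operatorname{Hom}_R(F^e_*R,R)$ and $f\in\mathfrak{c}$. Then: 1. for every ideal $\mathfrak{b}$ with $\mathfrak{a}\subseteq\sqrt{\mathfrak{b}}\ne(1)$ the maxima and the limit defining $c^{\mathfrak{b}}(\mathfrak{a})$ exist, and the set $\{c^{\mathfrak{b}}(\mathfrak{a})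 : \mathfrak{a}\subseteq\sqrt{\mathfrak{b}}\ne(1)\}$ (for the fixed ideal $\mathfrak{a}$) consists of rational numbers and has no accumulation points in $\mathbb{R}$; 2. if $R$ is $F$-split, then for every such $\mathfrak{b}$ the maxima and the limit defining $\operatorname{ct}^{\mathfrak{b}}(\mathfrak{a})$ exist, and the set $\{\operatorname{ct}^{\mathfrak{b}}(\mathfrak{a}) : \mathfrak{a}\subseteq\sqrt{\mathfrak{b}}\ne(1)\}$ consists of rational numbers and has no accumulation points in $\mathbb{R}$. -/

import Mathlib

open Filter Topology

universe u

/-- `F^e_* R`: the additive group of `R`, regarded as an `R`-module through the `e`-th iterated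
Frobenius `F^e : R → R`. -/
def FrobPush (R : Type u) (_p _e : ℕ) : Type u := R

namespace FrobPush

variable {R : Type u} [CommRing R] (p e : ℕ)

instance : AddCommGroup (FrobPush R p e) := inferInstanceAs (AddCommGroup R)

/-- The identity map `R → F^e_* R`, written `f ↦ F^e_* f`. -/
def of : R ≃+ FrobPush R p e := AddEquiv.refl R

/-- The module structure `g • F^e_* f = F^e_* (g ^ (p ^ e) * f)`. -/
noncomputable instance [ExpChar R p] : Module R (FrobPush R p e) :=
  Module.compHom R (iterateFrobenius R p e)

theorem smul_of [ExpChar R p] (g f : R) : g • of p e f = of p e (g ^ p ^ e * f) := rfl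

/-- The grading of `F^e_* R` by rational numbers, for `R` graded by natural numbers:
`deg (F^e_* r) = deg r / p ^ e`. -/
def grading {K : Type*} [Field K] [Algebra K R] (𝒜 : ℕ → Submodule K R) (q : ℚ) :
    AddSubgroup (FrobPush R p e) where
  carrier := {x | x = 0 ∨ ∃ n : ℕ, (n : ℚ) = (p : ℚ) ^ e * q ∧ ∃ r ∈ 𝒜 n, x = of p e r}
  zero_mem' := Or.inl rfl
  add_mem' := by
    rintro x y (hx | ⟨n, hn, r, hr, hx⟩) (hy | ⟨m, hm, s, hs, hy⟩)
    · exact Or.inl (by rw [hx, hy, add_zero])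
    · exact Or.inr ⟨m, hm, s, hs, by rw [hx, hy, zero_add]⟩
    · exact Or.inr ⟨n, hn, r, hr, by rw [hx, hy, add_zero]⟩
    · obtain rfl : n = m := by exact_mod_cast hn.trans hm.symm
      exact Or.inr ⟨n, hn, r + s, (𝒜 n).add_mem hr hs, by rw [hx, hy, map_add]⟩
  neg_mem' := by
    rintro x (hx | ⟨n, hn, r, hr, hx⟩)
    · exact Or.inl (by rw [hx, neg_zero])
    · exact Or.inr ⟨n, hn, -r, (𝒜 n).neg_mem hr, by rw [hx, map_neg]⟩

end FrobPush

/-- `ℳ` is a grading by rational numbers of the module `M` over the ring `R` graded by `𝒜`. -/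
structure IsGradedModule {K R : Type*} [Field K] [CommRing R] [Algebra K R]
    (𝒜 : ℕ → Submodule K R) {M : Type*} [AddCommGroup M] [Module R M]
    (ℳ : ℚ → AddSubgroup M) : Prop where
  isInternal : DirectSum.IsInternal ℳ
  smul_mem : ∀ (n : ℕ) (q : ℚ) (r : R) (m : M), r ∈ 𝒜 n → m ∈ ℳ q → r • m ∈ ℳ ((n : ℚ) + q)

/-- The grading of the shifted module `M(θ)`, namely `M(θ)_q = M_{q + θ}`. -/
def shiftGrading {M : Type*} [AddCommGroup M] (ℳ : ℚ → AddSubgroup M) (θ : ℚ) :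
    ℚ → AddSubgroup M := fun q => ℳ (q + θ)

/-- Finite `F`-representation type of a graded ring: there are finitely many finitely generated
graded modules `M i` such that for every `e` there is an isomorphism of graded modules
`F^e_* R ≅ ⨁ i, ⨁ j, M i (θ i j)`, with finitely many `j` for each `i` and all `θ i j ≤ 0`. -/
def HasFFRT {K : Type*} {R : Type u} [Field K] [CommRing R] [Algebra K R]
    (p : ℕ) [ExpChar R p] (𝒜 : ℕ → Submodule K R) : Prop :=
  ∃ (l : ℕ) (M : Fin l → Type u) (_ : ∀ i, AddCommGroup (M i)) (_ : ∀ i, Module R (M i))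
    (ℳ : ∀ i, ℚ → AddSubgroup (M i)),
    (∀ i, Module.Finite R (M i)) ∧ (∀ i, IsGradedModule 𝒜 (ℳ i)) ∧
    ∀ e : ℕ, ∃ (α : Fin l → ℕ) (θ : ∀ i, Fin (α i) → ℚ), (∀ i j, θ i j ≤ 0) ∧
      ∃ Φ : FrobPush R p e ≃ₗ[R] (∀ i, Fin (α i) → M i),
        ∀ (q : ℚ) (x : FrobPush R p e),
          x ∈ FrobPush.grading p e 𝒜 q ↔ ∀ i j, Φ x i j ∈ shiftGrading (ℳ i) (θ i j) q

section Thresholds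

variable {R : Type u} [CommRing R] (p : ℕ) [ExpChar R p]

/-- The Frobenius `R → F_* R` splits. -/
def IsFSplit (R : Type u) [CommRing R] (p : ℕ) [ExpChar R p] : Prop :=
  ∃ φ : FrobPush R p 1 →ₗ[R] R, φ (FrobPush.of p 1 1) = 1

/-- The Frobenius power `𝔟^{[p^e]}`, generated by the `p^e`-th powers of the elements of `𝔟`. -/
def frobPower (e : ℕ) (𝔟 : Ideal R) : Ideal R :=
  Ideal.span {x | ∃ f ∈ 𝔟, x = f ^ p ^ e}

/-- The ideal `C^e_R · 𝔞`, generated by all `φ (f)` with `φ ∈ Hom_R(F^e_* R, R)`, `f ∈ 𝔞`. -/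
def cartierIdeal (e : ℕ) (𝔞 : Ideal R) : Ideal R :=
  Ideal.span {x | ∃ φ : FrobPush R p e →ₗ[R] R, ∃ f ∈ 𝔞, x = φ (FrobPush.of p e f)}

/-- `c` is the `F`-threshold of `𝔞` in `𝔟`: the maxima `ν e` of `{n | 𝔞^n ⊄ 𝔟^{[p^e]}}` exist, and
`ν e / p^e` converges to `c`. -/
def IsFThreshold (𝔞 𝔟 : Ideal R) (c : ℝ) : Prop :=
  ∃ ν : ℕ → ℕ, (∀ e, IsGreatest {n : ℕ | ¬ 𝔞 ^ n ≤ frobPower p e 𝔟} (ν e)) ∧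
    Tendsto (fun e => (ν e : ℝ) / (p : ℝ) ^ e) atTop (𝓝 c)

/-- `c` is the Cartier threshold of `𝔞` in `𝔟`: the maxima `ν e` of `{n | C^e_R · 𝔞^n ⊄ 𝔟}` exist,
and `ν e / p^e` converges to `c`. -/
def IsCartierThreshold (𝔞 𝔟 : Ideal R) (c : ℝ) : Prop :=
  ∃ ν : ℕ → ℕ, (∀ e, IsGreatest {n : ℕ | ¬ cartierIdeal p e (𝔞 ^ n) ≤ 𝔟} (ν e)) ∧
    Tendsto (fun e => (ν e : ℝ) / (p : ℝ) ^ e) atTop (𝓝 c)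

/-- The set of all `F`-thresholds of `𝔞`, in all ideals `𝔟` with `𝔞 ⊆ √𝔟 ≠ (1)`. -/
def fThresholds (𝔞 : Ideal R) : Set ℝ :=
  {c | ∃ 𝔟 : Ideal R, 𝔞 ≤ 𝔟.radical ∧ 𝔟.radical ≠ ⊤ ∧ IsFThreshold p 𝔞 𝔟 c}

/-- The set of all Cartier thresholds of `𝔞`, in all ideals `𝔟` with `𝔞 ⊆ √𝔟 ≠ (1)`. -/
def cartierThresholds (𝔞 : Ideal R) : Set ℝ :=
  {c | ∃ 𝔟 : Ideal R, 𝔞 ≤ 𝔟.radical ∧ 𝔟.radical ≠ ⊤ ∧ IsCartierThreshold p 𝔞 𝔟 c}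

end Thresholds

/-! Let `D^e = End_R (F^e_* R)` and call `n` a jump at level `e` if `D^e · 𝔞^n ≠ D^e · 𝔞^(n+1)`
(`diffJumps`). Frobenius powers `𝔟^{[p^e']}` with `e ≤ e'` are stable under `D^e`, and `Hom_R(F^e'_*
R, R)` absorbs `D^e` by composition. Hence the maxima `ν e'` behind either kind of threshold are
jumps at every level `e ≤ e'`.

The central bound is `HasFFRT.exists_card_diffJumps_le`: below `A * p^e` the number of jumps is
bounded independently of `e`. There `F^e_* 𝔞^n` is generated in rational degrees at most a constant
`c + d * A`. Under the decomposition of `F^e_* R`, a `D^e`-submodule is given by one submodule of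
each `M i`, and the shifts `θ ≤ 0` do not raise degrees. The chain `D^e · 𝔞^n` is thus controlled by
its traces on fixed finite-dimensional spaces `V i ⊆ M i`, so it drops at most `∑ dim V i` times.

Discreteness follows: many distinct thresholds below `A` would give as many distinct jumps below `A
* p^e` for large `e`. For rationality, a Skoda-type inclusion shows that a jump `n ≥ μ * p^e` yields
the jump `n - p^e`, so jumps occupy at most `C` residue classes modulo `p^e`. Among `ν e, …, ν (e +
C)`, all jumps at level `e`, two are congruent modulo `p^e`. Dividing by `p^e` and passing to the
limit gives `p^k * c - p^k' * c ∈ ℤ` for some `k ≠ k'`. -/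

theorem card_le_of_forall_succ_lt {d : ℕ → ℕ} (hd : Antitone d) (S : Finset ℕ)
    (hS : ∀ n ∈ S, d (n + 1) < d n) : S.card ≤ d 0 := by
  have hlt : ∀ n ∈ S, ∀ m ∈ S, n < m → d m < d n := fun n hn m _ h =>
    (hd (Nat.succ_le_of_lt h)).trans_lt (hS n hn)
  calc S.card ≤ (Finset.Icc 1 (d 0)).card := by
        refine Finset.card_le_card_of_injOn d (fun n hn => ?_) (fun n hn m hm h => ?_)
        · exact Finset.mem_coe.2 (Finset.mem_Icc.2
            ⟨Nat.one_le_of_lt (hS n hn), hd (Nat.zero_le n)⟩)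
        · by_contra hne
          rcases lt_or_gt_of_ne hne with h' | h'
          · exact (hlt n hn m hm h').ne' h
          · exact (hlt m hm n hn h').ne h
    _ = d 0 := by simp

/-! ### Limits of normalized jumps: discreteness, rationality, convergence. -/

section Combinatorics

variable {p : ℕ} {J : ℕ → Set ℕ}

theorem finite_inter_Iio_of_card_le (hp : 0 < p)
    (hJ : ∀ A : ℕ, ∃ C : ℕ, ∀ (e : ℕ) (S : Finset ℕ), (S : Set ℕ) ⊆ J e →
      (∀ n ∈ S, n < A * p ^ e) → S.card ≤ C)
    {T : Set ℝ} (hT : ∀ c ∈ T, ∃ ν : ℕ → ℕ, (∀ e, ν e ∈ J e) ∧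
      Tendsto (fun e => (ν e : ℝ) / (p : ℝ) ^ e) atTop (𝓝 c)) (A : ℕ) :
    (T ∩ Set.Iio (A : ℝ)).Finite := by
  classical
  by_contra hinf
  obtain ⟨C, hC⟩ := hJ A
  obtain ⟨F, hF, hcard⟩ := Set.Infinite.exists_subset_card_eq hinf (C + 1)
  choose! ν hν hlim using hT
  have hFT : ∀ c ∈ F, c ∈ T := fun c hc => (hF hc).1
  have h1 : ∀ᶠ e in atTop, ∀ c ∈ F, (ν c e : ℝ) / (p : ℝ) ^ e < A :=
    (Filter.eventually_all_finset F).2 fun c hc =>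
      (hlim c (hFT c hc)).eventually (gt_mem_nhds (hF hc).2)
  -- Distinct limits force distinct terms for large `e`, so `C + 1` limits produce `C + 1` jumps.
  have h2 : ∀ᶠ e in atTop, ∀ c ∈ F, ∀ c' ∈ F, c ≠ c' → ν c e ≠ ν c' e := by
    refine (Filter.eventually_all_finset F).2 fun c hc =>
      (Filter.eventually_all_finset F).2 fun c' hc' => ?_
    by_cases hne : c = c'
    · exact Eventually.of_forall fun _ h => absurd hne h
    · filter_upwards [((hlim c (hFT c hc)).sub
        (hlim c' (hFT c' hc'))).eventually_ne (sub_ne_zero.2 hne)] with e he _ h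
      exact he (by rw [h, sub_self])
  obtain ⟨e, he1, he2⟩ := (h1.and h2).exists
  have hinj : Set.InjOn (fun c => ν c e) F := fun c hc c' hc' h => by
    by_contra hne
    exact he2 c hc c' hc' hne h
  have := hC e (F.image fun c => ν c e) (fun n hn => ?_) (fun n hn => ?_)
  · rw [Finset.card_image_of_injOn hinj, hcard] at this
    omega
  · obtain ⟨c, hc, rfl⟩ := Finset.mem_image.1 (Finset.mem_coe.1 hn)
    exact hν c (hFT c hc) e
  · obtain ⟨c, hc, rfl⟩ := Finset.mem_image.1 hn
    have := he1 c hc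
    rw [div_lt_iff₀ (by positivity)] at this
    exact_mod_cast this

theorem not_accPt_of_finite_inter_Iio {T : Set ℝ}
    (hT : ∀ A : ℕ, (T ∩ Set.Iio (A : ℝ)).Finite) (x : ℝ) : ¬ AccPt x (𝓟 T) := by
  intro h
  obtain ⟨A, hA⟩ := exists_nat_gt x
  have := h.nhds_inter (Iio_mem_nhds hA)
  rw [Set.inter_comm] at this
  exact Set.Infinite.of_accPt this (hT A)

/-- Subtracting `p ^ e` repeatedly keeps the residue class. A bound on the elements below `A * p ^
e` therefore bounds the residues of all elements. -/
theorem exists_lt_modEq_of_sub_mem (hp : 0 < p) {A e : ℕ}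
    (hJ : ∀ n ∈ J e, A * p ^ e ≤ n → p ^ e ≤ n ∧ n - p ^ e ∈ J e) :
    ∀ n ∈ J e, ∃ m ∈ J e, m < A * p ^ e ∧ m ≡ n [MOD p ^ e] := by
  intro n
  induction n using Nat.strong_induction_on with
  | _ n ih =>
    intro hn
    rcases lt_or_ge n (A * p ^ e) with h | h
    · exact ⟨n, hn, h, rfl⟩
    · obtain ⟨h1, h2⟩ := hJ n hn h
      have hq : 0 < p ^ e := by positivity
      obtain ⟨m, hm, hlt, hmod⟩ := ih (n - p ^ e) (by omega) h2
      exact ⟨m, hm, hlt, hmod.trans (by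
        conv_rhs => rw [← Nat.sub_add_cancel h1]
        simp [Nat.ModEq])⟩

theorem exists_rat_eq_of_card_le (hp : 2 ≤ p) {A C : ℕ}
    (hJ : ∀ (e : ℕ) (S : Finset ℕ), (S : Set ℕ) ⊆ J e →
      (∀ n ∈ S, n < A * p ^ e) → S.card ≤ C)
    (hsub : ∀ e, ∀ n ∈ J e, A * p ^ e ≤ n → p ^ e ≤ n ∧ n - p ^ e ∈ J e)
    {c : ℝ} {ν : ℕ → ℕ} (hν : ∀ e e', e ≤ e' → ν e' ∈ J e)
    (hc : Tendsto (fun e => (ν e : ℝ) / (p : ℝ) ^ e) atTop (𝓝 c)) : ∃ q : ℚ, (q : ℝ) = c := by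
  classical
  have hp0 : (0 : ℝ) < p := by exact_mod_cast (by omega : 0 < p)
  -- Dividing by `p ^ e` rather than `p ^ (e + k)` multiplies the limit by `p ^ k`.
  have hlim : ∀ k, Tendsto (fun e => (ν (e + k) : ℝ) / (p : ℝ) ^ e) atTop (𝓝 (p ^ k * c)) := by
    intro k
    refine (((tendsto_add_atTop_iff_nat k).2 hc).const_mul ((p : ℝ) ^ k)).congr fun e => ?_
    rw [pow_add]
    field_simp
  have key : ∃ k ∈ Finset.range (C + 1), ∃ k' ∈ Finset.range (C + 1), k ≠ k' ∧
      (p : ℝ) ^ k * c - p ^ k' * c ∈ Set.range ((↑) : ℤ → ℝ) := by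
    -- The pair found by pigeonhole depends on `e`. Since `ℤ` is closed in `ℝ`, failure for all of
    -- the finitely many pairs would persist at a single large `e`, where pigeonhole refutes it.
    by_contra! hcon
    have hev : ∀ᶠ e in atTop, ∀ k ∈ Finset.range (C + 1), ∀ k' ∈ Finset.range (C + 1), k ≠ k' →
        (ν (e + k) : ℝ) / (p : ℝ) ^ e - (ν (e + k') : ℝ) / (p : ℝ) ^ e ∈
          (Set.range ((↑) : ℤ → ℝ))ᶜ := by
      refine (Filter.eventually_all_finset _).2 fun k hk =>
        (Filter.eventually_all_finset _).2 fun k' hk' => ?_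
      by_cases hne : k = k'
      · exact Eventually.of_forall fun _ h => absurd hne h
      · filter_upwards [((hlim k).sub (hlim k')).eventually
          (Real.isClosed_range_intCast.isOpen_compl.mem_nhds (hcon k hk k' hk' hne))] with e he _
        exact he
    obtain ⟨e, he⟩ := hev.exists
    choose! m hmJ hlt hmod using exists_lt_modEq_of_sub_mem (by omega) (hsub e)
    have hmem : ∀ k, ν (e + k) ∈ J e := fun k => hν e (e + k) (by omega)
    have hcard := hJ e ((Finset.range (C + 1)).image fun k => m (ν (e + k)))
      (fun n hn => by
        obtain ⟨k, _, rfl⟩ := Finset.mem_image.1 (Finset.mem_coe.1 hn)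
        exact hmJ _ (hmem k))
      (fun n hn => by
        obtain ⟨k, _, rfl⟩ := Finset.mem_image.1 hn
        exact hlt _ (hmem k))
    obtain ⟨k, hk, k', hk', hne, heq⟩ := Finset.exists_ne_map_eq_of_card_lt_of_maps_to
      (s := Finset.range (C + 1))
      (t := (Finset.range (C + 1)).image fun k => m (ν (e + k))) (f := fun k => m (ν (e + k)))
      (by rw [Finset.card_range]; exact Nat.lt_succ_of_le hcard)
      (fun k hk => Finset.mem_coe.2
        (Finset.mem_image_of_mem (fun k => m (ν (e + k))) (Finset.mem_coe.1 hk)))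
    refine he k hk k' hk' hne ?_
    have hmod' : ν (e + k') ≡ ν (e + k) [MOD p ^ e] :=
      (hmod _ (hmem k')).symm.trans ((by rw [heq] : m (ν (e + k')) ≡ m (ν (e + k)) [MOD p ^ e]).trans
        (hmod _ (hmem k)))
    obtain ⟨z, hz⟩ := (Nat.modEq_iff_dvd.1 hmod')
    refine ⟨z, ?_⟩
    have hz' : (ν (e + k) : ℝ) - ν (e + k') = (p : ℝ) ^ e * z := by exact_mod_cast hz
    rw [← sub_div, hz']
    field_simp
  obtain ⟨k, _, k', _, hne, z, hz⟩ := key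
  have hpow : (p : ℝ) ^ k - (p : ℝ) ^ k' ≠ 0 := by
    rw [sub_ne_zero]
    exact_mod_cast fun h => hne (Nat.pow_right_injective hp h)
  refine ⟨(z : ℚ) / ((p : ℚ) ^ k - (p : ℚ) ^ k'), ?_⟩
  push_cast
  rw [div_eq_iff hpow, hz]
  ring

/-- Replacing `ν e` by `ν e + 2 * B` makes the quotients antitone, because `p * B + 2 * B ≤ 2 * p *
B` for `p ≥ 2`; the correction `2 * B / p ^ e` vanishes in the limit. -/
theorem exists_tendsto_div_pow_of_le {B : ℕ} {ν : ℕ → ℕ} (hp : 2 ≤ p)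
    (hν : ∀ e, ν (e + 1) ≤ p * (ν e + B)) :
    ∃ c : ℝ, Tendsto (fun e => (ν e : ℝ) / (p : ℝ) ^ e) atTop (𝓝 c) := by
  have hp0 : (0 : ℝ) < p := by exact_mod_cast (by omega : 0 < p)
  have hp1 : (1 : ℝ) < p := by exact_mod_cast (by omega : 1 < p)
  have hanti : Antitone fun e => ((ν e : ℝ) + 2 * B) / (p : ℝ) ^ e := by
    refine antitone_nat_of_succ_le fun e => ?_
    rw [div_le_div_iff₀ (by positivity) (by positivity), pow_succ]
    have h1 : ν (e + 1) + 2 * B ≤ p * (ν e + 2 * B) := by nlinarith [hν e]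
    have h2 : (ν (e + 1) : ℝ) + 2 * B ≤ p * (ν e + 2 * B) := by exact_mod_cast h1
    calc ((ν (e + 1) : ℝ) + 2 * B) * (p : ℝ) ^ e
        ≤ (p * (ν e + 2 * B)) * (p : ℝ) ^ e := by gcongr
      _ = _ := by ring
  have hlim := tendsto_atTop_ciInf hanti
    ⟨0, by rintro _ ⟨e, rfl⟩; positivity⟩
  have hzero : Tendsto (fun e => (2 * B : ℝ) / (p : ℝ) ^ e) atTop (𝓝 0) :=
    (tendsto_pow_atTop_atTop_of_one_lt hp1).const_div_atTop _
  refine ⟨_, (hlim.sub hzero).congr fun e => ?_⟩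
  rw [← sub_div, add_sub_cancel_right]

theorem exists_tendsto_div_pow_of_ge {B : ℕ} {ν : ℕ → ℕ} (hp : 0 < p)
    (hν : ∀ e, p * ν e ≤ ν (e + 1)) (hB : ∀ e, ν e ≤ B * p ^ e) :
    ∃ c : ℝ, Tendsto (fun e => (ν e : ℝ) / (p : ℝ) ^ e) atTop (𝓝 c) := by
  have hp0 : (0 : ℝ) < p := by exact_mod_cast hp
  have hmono : Monotone fun e => (ν e : ℝ) / (p : ℝ) ^ e := by
    refine monotone_nat_of_le_succ fun e => ?_
    rw [div_le_div_iff₀ (by positivity) (by positivity), pow_succ]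
    have h2 : (p : ℝ) * ν e ≤ ν (e + 1) := by exact_mod_cast hν e
    calc (ν e : ℝ) * ((p : ℝ) ^ e * p) = (p * ν e) * (p : ℝ) ^ e := by ring
      _ ≤ _ := by gcongr
  refine ⟨_, tendsto_atTop_ciSup hmono ⟨B, ?_⟩⟩
  rintro _ ⟨e, rfl⟩
  show (ν e : ℝ) / (p : ℝ) ^ e ≤ B
  rw [div_le_iff₀ (by positivity)]
  exact_mod_cast hB e

end Combinatorics

/-! ### Skoda-type inclusion for powers of an ideal. -/

theorem Ideal.exists_pow_le_span_pow_mul {R : Type*} [CommRing R] {I : Ideal R} (hI : I.FG) :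
    ∃ μ : ℕ, 0 < μ ∧ ∀ q n : ℕ, μ * q ≤ n →
      I ^ n ≤ Ideal.span {x | ∃ f ∈ I, x = f ^ q} * I ^ (n - q) := by
  obtain ⟨k, x, rfl⟩ := (Submodule.fg_iff_exists_fin_generating_family).1 hI
  change ∃ μ : ℕ, 0 < μ ∧ ∀ q n : ℕ, μ * q ≤ n → Ideal.span (Set.range x) ^ n ≤
      Ideal.span {y | ∃ f ∈ Ideal.span (Set.range x), y = f ^ q} * Ideal.span (Set.range x) ^ (n - q)
  -- A monomial of degree at least `(k + 1) * q` in `k` generators has some exponent at least `q`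
  -- when `q > 0`. Taking `k + 1` instead of `k` keeps `μ` positive and covers `k = 0`.
  refine ⟨k + 1, k.succ_pos, fun q n hqn y hy => ?_⟩
  obtain ⟨P, hP, rfl⟩ := (Ideal.mem_span_pow_iff_exists_isHomogeneous x y).1 hy
  rw [MvPolynomial.eval_eq']
  refine Ideal.sum_mem _ fun d hd => Ideal.mul_mem_left _ _ ?_
  have hdeg : ∑ i, d i = n := by
    rw [← Finsupp.degree_eq_sum, Finsupp.degree_eq_weight_one]
    exact hP (MvPolynomial.mem_support_iff.1 hd)
  rcases Nat.eq_zero_or_pos q with rfl | hq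
  · have h1 : (1 : R) ∈ Ideal.span {y | ∃ f ∈ Ideal.span (Set.range x), y = f ^ 0} :=
      Ideal.subset_span ⟨0, zero_mem _, (pow_zero _).symm⟩
    rw [← one_mul (∏ i, _), Nat.sub_zero, ← hdeg]
    refine Ideal.mul_mem_mul h1 ?_
    rw [← Finset.prod_pow_eq_pow_sum]
    exact Ideal.prod_mem_prod fun i _ =>
      Ideal.pow_mem_pow (Ideal.subset_span (Set.mem_range_self i)) _
  obtain ⟨i, -, hi⟩ : ∃ i ∈ Finset.univ, q ≤ d i := by
    by_contra! hcon
    have h1 : ∑ i, d i ≤ ∑ _i : Fin k, q := Finset.sum_le_sum fun i hi => (hcon i hi).le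
    simp only [Finset.sum_const, Finset.card_univ, Fintype.card_fin, smul_eq_mul] at h1
    rw [add_mul, one_mul] at hqn
    omega
  rw [← Finset.mul_prod_erase _ _ (Finset.mem_univ i), ← Nat.add_sub_cancel' hi, pow_add, mul_assoc]
  refine Ideal.mul_mem_mul (Ideal.subset_span
    ⟨x i, Ideal.subset_span (Set.mem_range_self i), rfl⟩) ?_
  have hsum : n - q = (d i - q) + ∑ j ∈ Finset.univ.erase i, d j := by
    rw [← hdeg, ← Finset.add_sum_erase _ _ (Finset.mem_univ i)]
    omega
  rw [hsum, pow_add, ← Finset.prod_pow_eq_pow_sum]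
  exact Ideal.mul_mem_mul (Ideal.pow_mem_pow (Ideal.subset_span (Set.mem_range_self i)) _)
    (Ideal.prod_mem_prod fun j _ => Ideal.pow_mem_pow (Ideal.subset_span (Set.mem_range_self j)) _)

/-! ### Frobenius powers, `D^e`-spans and Cartier ideals. -/

section Frobenius

variable {R : Type u} [CommRing R] (p : ℕ) [ExpChar R p]

theorem frobPower_eq_map (e : ℕ) (I : Ideal R) :
    frobPower p e I = I.map (iterateFrobenius R p e) := by
  rw [frobPower, Ideal.map]
  congr 1
  ext x
  simp [iterateFrobenius_def, eq_comm]

theorem frobPower_pow (e n : ℕ) (I : Ideal R) :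
    frobPower p e I ^ n = frobPower p e (I ^ n) := by
  simp only [frobPower_eq_map, Ideal.map_pow]

theorem frobPower_mono (e : ℕ) {I J : Ideal R} (h : I ≤ J) :
    frobPower p e I ≤ frobPower p e J := by
  simpa only [frobPower_eq_map] using Ideal.map_mono h

theorem frobPower_frobPower (e k : ℕ) (I : Ideal R) :
    frobPower p k (frobPower p e I) = frobPower p (e + k) I := by
  simp only [frobPower_eq_map, Ideal.map_map]
  congr 1
  ext x
  simp [iterateFrobenius_def, ← pow_mul, pow_add]

omit [ExpChar R p] in
variable {p} in
theorem frobPower_le_self (hp : 0 < p) (e : ℕ) (I : Ideal R) : frobPower p e I ≤ I :=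
  Ideal.span_le.2 fun _ ⟨_, hf, hx⟩ =>
    hx ▸ I.pow_mem_of_mem hf _ (by positivity)

omit [ExpChar R p] in
variable {p} in
theorem frobPower_le_pow (e : ℕ) (I : Ideal R) : frobPower p e I ≤ I ^ p ^ e :=
  Ideal.span_le.2 fun _ ⟨_, hf, hx⟩ => hx ▸ Ideal.pow_mem_pow hf _

/-- The `R`-submodule `F^e_* I` of `F^e_* R`. -/
noncomputable def frobPushIdeal (e : ℕ) (I : Ideal R) : Submodule R (FrobPush R p e) where
  carrier := {x | (FrobPush.of p e).symm x ∈ I}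
  add_mem' := fun hx hy => I.add_mem hx hy
  zero_mem' := I.zero_mem
  smul_mem' := fun g _ hx => I.mul_mem_left (g ^ p ^ e) hx

theorem of_mem_frobPushIdeal {e : ℕ} {I : Ideal R} {f : R} :
    FrobPush.of p e f ∈ frobPushIdeal p e I ↔ f ∈ I := Iff.rfl

theorem frobPushIdeal_mono (e : ℕ) {I J : Ideal R} (h : I ≤ J) :
    frobPushIdeal p e I ≤ frobPushIdeal p e J := fun _ hx => h hx

theorem frobPushIdeal_frobPower_mul_le (e : ℕ) (I J : Ideal R) :
    frobPushIdeal p e (frobPower p e I * J) ≤ I • frobPushIdeal p e J := by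
  have h1 : ∀ a ∈ frobPower p e I, ∀ b ∈ J, FrobPush.of p e (a * b) ∈ I • frobPushIdeal p e J := by
    intro a ha
    induction ha using Submodule.span_induction with
    | mem y hy =>
      obtain ⟨f, hf, rfl⟩ := hy
      intro b hb
      rw [← FrobPush.smul_of]
      exact Submodule.smul_mem_smul hf ((of_mem_frobPushIdeal p).2 hb)
    | zero =>
      intro b _
      rw [zero_mul, map_zero]
      exact zero_mem _
    | add y z _ _ hy hz =>
      intro b hb
      rw [add_mul, map_add]
      exact add_mem (hy b hb) (hz b hb)
    | smul r y _ hy =>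
      intro b hb
      rw [smul_eq_mul, mul_comm r y, mul_assoc]
      exact hy _ (J.mul_mem_left r hb)
  intro x hx
  obtain ⟨y, rfl⟩ := (FrobPush.of p e).surjective x
  rw [of_mem_frobPushIdeal] at hx
  exact Submodule.mul_induction_on (C := fun y => FrobPush.of p e y ∈ I • frobPushIdeal p e J) hx h1
    fun a b ha hb => by rw [map_add]; exact add_mem ha hb

/-- The `D^e`-module generated by `F^e_* I`, for `D^e = End_R (F^e_* R)`. -/
noncomputable def diffSpan (e : ℕ) (I : Ideal R) : Submodule R (FrobPush R p e) :=
  ⨆ ψ : FrobPush R p e →ₗ[R] FrobPush R p e, (frobPushIdeal p e I).map ψ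

variable {p}

theorem apply_mem_diffSpan {e : ℕ} {I : Ideal R} (ψ : FrobPush R p e →ₗ[R] FrobPush R p e)
    {x : FrobPush R p e} (hx : x ∈ frobPushIdeal p e I) : ψ x ∈ diffSpan p e I :=
  Submodule.mem_iSup_of_mem ψ (Submodule.mem_map_of_mem hx)

theorem diffSpan_mono {e : ℕ} {I J : Ideal R} (h : I ≤ J) : diffSpan p e I ≤ diffSpan p e J :=
  iSup_mono fun _ => Submodule.map_mono (frobPushIdeal_mono p e h)

theorem smul_diffSpan_le (e : ℕ) (I J : Ideal R) :
    I • diffSpan p e J ≤ diffSpan p e (frobPower p e I * J) := by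
  refine Submodule.smul_le.2 fun a ha x hx => ?_
  suffices diffSpan p e J ≤ (diffSpan p e (frobPower p e I * J)).comap 
      (LinearMap.lsmul R (FrobPush R p e) a) from this hx
  refine iSup_le fun ψ => ?_
  rintro _ ⟨y, hy, rfl⟩
  rw [Submodule.mem_comap, LinearMap.lsmul_apply, ← map_smul]
  obtain ⟨f, rfl⟩ := (FrobPush.of p e).surjective y
  rw [FrobPush.smul_of]
  exact apply_mem_diffSpan ψ ((of_mem_frobPushIdeal p).2 <|
    Ideal.mul_mem_mul (Ideal.subset_span ⟨a, ha, rfl⟩) hy)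

/-- An endomorphism of `F^e_* R` regarded as an endomorphism of `F^e'_* R` for `e ≤ e'`. -/
noncomputable def FrobPush.liftEnd {e e' : ℕ} (h : e ≤ e') (ψ : FrobPush R p e →ₗ[R] FrobPush R p e) :
    FrobPush R p e' →ₗ[R] FrobPush R p e' where
  toFun x := FrobPush.of p e' ((FrobPush.of p e).symm
    (ψ (FrobPush.of p e ((FrobPush.of p e').symm x))))
  map_add' x y := by simp
  map_smul' g x := by
    obtain ⟨f, rfl⟩ := (FrobPush.of p e').surjective x
    obtain ⟨k, rfl⟩ := Nat.exists_eq_add_of_le' h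
    have hg : ∀ f : R, FrobPush.of p e (g ^ p ^ (k + e) * f) = (g ^ p ^ k) • FrobPush.of p e f := by
      intro f
      rw [FrobPush.smul_of, ← pow_mul, ← pow_add]
    rw [FrobPush.smul_of, AddEquiv.symm_apply_apply, AddEquiv.symm_apply_apply, hg, map_smul,
      RingHom.id_apply, FrobPush.smul_of]
    obtain ⟨f', hf'⟩ := (FrobPush.of p e).surjective (ψ (FrobPush.of p e f))
    rw [← hf', ← hg, AddEquiv.symm_apply_apply, AddEquiv.symm_apply_apply]

/-- Multiplication by `r` on `F^e_* R`. -/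
noncomputable def FrobPush.mulEnd (e : ℕ) (r : R) : FrobPush R p e →ₗ[R] FrobPush R p e where
  toFun x := FrobPush.of p e (r * (FrobPush.of p e).symm x)
  map_add' x y := by simp [mul_add]
  map_smul' g x := by
    obtain ⟨f, rfl⟩ := (FrobPush.of p e).surjective x
    simp only [FrobPush.smul_of, AddEquiv.symm_apply_apply, RingHom.id_apply]
    rw [mul_left_comm]

/-- With `e' = k + e`, the submodule `F^e_* (J^{[p^e']})` equals `J^{[p^k]} • F^e_* R`, and a
submodule of this form is stable under every `R`-linear endomorphism. -/
theorem diffSpan_le_of_le_frobPower {e e' : ℕ} (h : e ≤ e') {I J : Ideal R}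
    (hI : I ≤ frobPower p e' J) : diffSpan p e I ≤ frobPushIdeal p e (frobPower p e' J) := by
  obtain ⟨k, rfl⟩ := Nat.exists_eq_add_of_le' h
  have key : frobPushIdeal p e (frobPower p (k + e) J) ≤
      frobPower p k J • (⊤ : Submodule R (FrobPush R p e)) := by
    rw [← frobPower_frobPower]
    refine (frobPushIdeal_mono p e (Ideal.mul_top _).ge).trans
      ((frobPushIdeal_frobPower_mul_le p e _ ⊤).trans (Submodule.smul_mono le_rfl le_top))
  have key' : frobPower p k J • (⊤ : Submodule R (FrobPush R p e)) ≤
      frobPushIdeal p e (frobPower p (k + e) J) := by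
    rw [← frobPower_frobPower]
    refine Submodule.smul_le.2 fun a ha x _ => ?_
    obtain ⟨f, rfl⟩ := (FrobPush.of p e).surjective x
    rw [FrobPush.smul_of, of_mem_frobPushIdeal]
    exact Ideal.mul_mem_right _ _ (Ideal.subset_span ⟨a, ha, rfl⟩)
  refine iSup_le fun ψ => ?_
  calc (frobPushIdeal p e I).map ψ
      ≤ (frobPower p k J • (⊤ : Submodule R (FrobPush R p e))).map ψ :=
        Submodule.map_mono ((frobPushIdeal_mono p e hI).trans key)
    _ ≤ frobPower p k J • (⊤ : Submodule R (FrobPush R p e)) := by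
        rw [Submodule.map_smul'']
        exact Submodule.smul_mono le_rfl le_top
    _ ≤ _ := key'

theorem cartierIdeal_le_iff {e : ℕ} {I J : Ideal R} :
    cartierIdeal p e I ≤ J ↔
      ∀ φ : FrobPush R p e →ₗ[R] R, ∀ f ∈ I, φ (FrobPush.of p e f) ∈ J := by
  rw [cartierIdeal, Ideal.span_le]
  exact ⟨fun h φ f hf => h ⟨φ, f, hf, rfl⟩, by rintro h _ ⟨φ, f, hf, rfl⟩; exact h φ f hf⟩

/-- An `R`-linear endomorphism of `F^e_* R` is also linear on `F^e'_* R`, so precomposing `φ` with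
it gives another map in `Hom_R(F^e'_* R, R)`. -/
theorem cartierIdeal_le_of_le_diffSpan {e e' : ℕ} (h : e ≤ e') {I I' J : Ideal R}
    (hI : frobPushIdeal p e I' ≤ diffSpan p e I) (hJ : cartierIdeal p e' I ≤ J) :
    cartierIdeal p e' I' ≤ J := by
  rw [cartierIdeal_le_iff] at hJ ⊢
  -- `Q` collects the elements sent into `J` by every `φ`. It is closed under scalars because `φ`
  -- may be precomposed with multiplications.
  let Q : Submodule R (FrobPush R p e) :=
    { carrier := {x | ∀ φ : FrobPush R p e' →ₗ[R] R,
        φ (FrobPush.of p e' ((FrobPush.of p e).symm x)) ∈ J}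
      add_mem' := fun hx hy φ => by
        rw [map_add, map_add, map_add]
        exact add_mem (hx φ) (hy φ)
      zero_mem' := fun φ => by
        rw [map_zero, map_zero, map_zero]
        exact zero_mem _
      smul_mem' := fun g x hx φ => hx (φ ∘ₗ FrobPush.mulEnd e' (g ^ p ^ e)) }
  have hQ : diffSpan p e I ≤ Q := by
    refine iSup_le fun ψ => ?_
    rintro _ ⟨x, hx, rfl⟩ φ
    exact hJ (φ ∘ₗ FrobPush.liftEnd h ψ) _ hx
  exact fun φ f hf => hQ (hI ((of_mem_frobPushIdeal p).2 hf)) φ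

theorem cartierIdeal_frobPower_mul_le (e : ℕ) (I J : Ideal R) :
    cartierIdeal p e (frobPower p e I * J) ≤ I := by
  refine cartierIdeal_le_iff.2 fun φ f hf => ?_
  have h1 := frobPushIdeal_frobPower_mul_le p e I J ((of_mem_frobPushIdeal p).2 hf)
  have h2 := Submodule.mem_map_of_mem (f := φ) h1
  rw [Submodule.map_smul''] at h2
  have h3 := Submodule.smul_mono (le_refl I) (le_top (a := (frobPushIdeal p e J).map φ)) h2
  rwa [smul_eq_mul, Ideal.mul_top] at h3

theorem cartierIdeal_mono {e : ℕ} {I J : Ideal R} (h : I ≤ J) :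
    cartierIdeal p e I ≤ cartierIdeal p e J :=
  cartierIdeal_le_iff.2 fun φ f hf => Ideal.subset_span ⟨φ, f, h hf, rfl⟩

/-- If `σ` splits Frobenius, then `φ ∘ F^e_* σ` is defined on `F^(e+1)_* R` and takes at `f ^ p` the
value of `φ` at `f`. This gives `p * ν e ≤ ν (e + 1)` for the Cartier maxima. -/
theorem IsFSplit.cartierIdeal_le_succ (hR : IsFSplit R p) {e n : ℕ} {I J : Ideal R}
    (h : cartierIdeal p (e + 1) (I ^ (p * n)) ≤ J) : cartierIdeal p e (I ^ n) ≤ J := by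
  obtain ⟨σ, hσ⟩ := hR
  rw [cartierIdeal_le_iff] at h ⊢
  intro φ f hf
  have hσ' : ∀ g f : R, σ (FrobPush.of p 1 (g ^ p * f)) = g * σ (FrobPush.of p 1 f) := by
    intro g f
    rw [← smul_eq_mul g, ← map_smul, FrobPush.smul_of, pow_one]
  let φ' : FrobPush R p (e + 1) →ₗ[R] R :=
    { toFun := fun x => φ (FrobPush.of p e (σ (FrobPush.of p 1 ((FrobPush.of p (e + 1)).symm x))))
      map_add' := fun x y => by simp
      map_smul' := fun g x => by
        obtain ⟨f, rfl⟩ := (FrobPush.of p (e + 1)).surjective x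
        rw [FrobPush.smul_of, AddEquiv.symm_apply_apply, AddEquiv.symm_apply_apply, pow_succ,
          pow_mul, hσ', ← FrobPush.smul_of, map_smul, RingHom.id_apply] }
  have := h φ' (f ^ p) (by rw [mul_comm, pow_mul]; exact Ideal.pow_mem_pow hf p)
  have h2 : φ' (FrobPush.of p (e + 1) (f ^ p)) = φ (FrobPush.of p e f) := by
    change φ (FrobPush.of p e (σ (FrobPush.of p 1 (f ^ p)))) = _
    rw [← mul_one (f ^ p), hσ', hσ, mul_one]
  rwa [h2] at this

theorem IsFSplit.cartierIdeal_top (hR : IsFSplit R p) (e : ℕ) :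
    cartierIdeal p e (⊤ : Ideal R) = ⊤ := by
  rw [eq_top_iff]
  induction e with
  | zero =>
    let φ : FrobPush R p 0 →ₗ[R] R :=
      { toFun := fun x => (FrobPush.of p 0).symm x
        map_add' := fun x y => map_add _ x y
        map_smul' := fun g x => by
          obtain ⟨f, rfl⟩ := (FrobPush.of p 0).surjective x
          rw [FrobPush.smul_of]
          simp }
    refine fun r _ => Ideal.subset_span ⟨φ, r, trivial, rfl⟩
  | succ e ih =>
    have := hR.cartierIdeal_le_succ (e := e) (n := 1) (I := ⊤)
      (J := cartierIdeal p (e + 1) (⊤ : Ideal R)) (by rw [Ideal.top_pow])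
    rw [pow_one] at this
    exact ih.trans this

end Frobenius

/-! ### The degree filtration on `R`. -/

section Grading

variable {K R : Type*} [Field K] [CommRing R] [Algebra K R] (𝒜 : ℕ → Submodule K R)

/-- The elements of degree at most `m`. -/
def degLE (m : ℕ) : Submodule K R := ⨆ i : Set.Iic m, 𝒜 i

variable {𝒜}

theorem mem_degLE {i m : ℕ} (h : i ≤ m) {x : R} (hx : x ∈ 𝒜 i) : x ∈ degLE 𝒜 m :=
  Submodule.mem_iSup_of_mem (p := fun i : Set.Iic m => 𝒜 i) ⟨i, h⟩ hx

theorem degLE_mono {m n : ℕ} (h : m ≤ n) : degLE 𝒜 m ≤ degLE 𝒜 n :=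
  iSup_le fun i _ hx => mem_degLE (i.2.trans h) hx

theorem degLE_le_of_forall {m : ℕ} {G : AddSubgroup R} (h : ∀ i ≤ m, ∀ x ∈ 𝒜 i, x ∈ G) {x : R}
    (hx : x ∈ degLE 𝒜 m) : x ∈ G :=
  Submodule.iSup_induction _ (motive := fun x => x ∈ G) hx (fun i x hx => h i i.2 x hx)
    G.zero_mem fun _ _ => G.add_mem

variable [GradedAlgebra 𝒜]

theorem mul_mem_degLE {m n : ℕ} {x y : R} (hx : x ∈ degLE 𝒜 m) (hy : y ∈ degLE 𝒜 n) :
    x * y ∈ degLE 𝒜 (m + n) := by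
  have h1 : degLE 𝒜 n ≤ (degLE 𝒜 (m + n)).comap (LinearMap.mulLeft K x) := by
    refine iSup_le fun j y hy => ?_
    have h2 : degLE 𝒜 m ≤ (degLE 𝒜 (m + n)).comap (LinearMap.mulRight K y) :=
      iSup_le fun i x hx => mem_degLE (add_le_add i.2 j.2) (SetLike.mul_mem_graded hx hy)
    exact h2 hx
  exact h1 hy

theorem one_mem_degLE (m : ℕ) : (1 : R) ∈ degLE 𝒜 m :=
  mem_degLE m.zero_le SetLike.GradedOne.one_mem

theorem pow_mem_degLE {m : ℕ} {x : R} (hx : x ∈ degLE 𝒜 m) (n : ℕ) :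
    x ^ n ∈ degLE 𝒜 (n * m) := by
  induction n with
  | zero => rw [pow_zero]; exact one_mem_degLE _
  | succ n ih => rw [pow_succ, Nat.succ_mul]; exact mul_mem_degLE ih hx

theorem prod_mem_degLE {ι : Type*} (s : Finset ι) {x : ι → R} {d : ι → ℕ}
    (hx : ∀ i ∈ s, x i ∈ degLE 𝒜 (d i)) : ∏ i ∈ s, x i ∈ degLE 𝒜 (∑ i ∈ s, d i) := by
  classical
  induction s using Finset.induction_on with
  | empty => exact one_mem_degLE _
  | insert a s ha ih =>
    rw [Finset.prod_insert ha, Finset.sum_insert ha]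
    exact mul_mem_degLE (hx a (Finset.mem_insert_self _ _))
      (ih fun i hi => hx i (Finset.mem_insert_of_mem hi))

variable (𝒜) in
theorem exists_mem_degLE (x : R) : ∃ m, x ∈ degLE 𝒜 m := by
  classical
  refine ⟨(DirectSum.decompose 𝒜 x).support.sup id, ?_⟩
  rw [← DirectSum.sum_support_decompose 𝒜 x]
  refine sum_mem fun i hi => ?_
  rw [DirectSum.sum_support_decompose 𝒜 x]
  exact mem_degLE (Finset.le_sup (f := id) hi) (SetLike.coe_mem _)

variable (𝒜) in
theorem Ideal.FG.exists_pow_le_span_degLE {I : Ideal R} (hI : I.FG) :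
    ∃ d : ℕ, ∀ n, I ^ n ≤ Ideal.span {x | x ∈ I ^ n ∧ x ∈ degLE 𝒜 (d * n)} := by
  obtain ⟨s, rfl⟩ := hI
  choose δ hδ using exists_mem_degLE 𝒜
  refine ⟨s.sup δ, fun n => ?_⟩
  induction n with
  | zero =>
    rw [pow_zero, Ideal.one_eq_top, ← Ideal.span_singleton_one]
    exact Ideal.span_mono (by
      rintro _ rfl
      exact ⟨Ideal.mem_span_singleton_self 1, one_mem_degLE _⟩)
  | succ n ih =>
    rw [pow_succ]
    refine (Ideal.mul_mono_left ih).trans ?_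
    rw [Ideal.span_mul_span']
    refine Ideal.span_mono ?_
    rintro _ ⟨x, ⟨hx, hx'⟩, y, hy, rfl⟩
    exact ⟨Ideal.mul_mem_mul hx (Ideal.subset_span hy),
      mul_mem_degLE hx' (degLE_mono (Finset.le_sup hy) (hδ y))⟩

end Grading

/-! ### Degree bounds for generators of `F^e_* R` and `F^e_* I^n`. -/

section FrobeniusGeneration

variable {K : Type*} {R : Type u} [Field K] [CommRing R] [Algebra K R] (𝒜 : ℕ → Submodule K R)
  [GradedAlgebra 𝒜] (p : ℕ) [ExpChar R p]

/-- Dividing exponents by `p ^ e` with remainder pulls a `p ^ e`-th power out of each monomial,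
leaving exponents below `p ^ e`. The coefficient in `K` stays with the remainder, so `K` need not be
perfect: only the degrees of the generators are bounded, not their number. -/
theorem exists_span_degLE_eq_top [Algebra.FiniteType K R] (hp : 0 < p) :
    ∃ c : ℕ, ∀ e : ℕ,
      Submodule.span R (FrobPush.of p e '' (degLE 𝒜 (c * p ^ e) : Set R)) = ⊤ := by
  obtain ⟨n, f, hf⟩ := (Algebra.FiniteType.iff_quotient_mvPolynomial'' (R := K) (S := R)).1
    inferInstance
  choose δ hδ using exists_mem_degLE 𝒜
  refine ⟨∑ i, δ (f (MvPolynomial.X i)), fun e => ?_⟩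
  rw [eq_top_iff]
  rintro y -
  obtain ⟨r, rfl⟩ := (FrobPush.of p e).surjective y
  obtain ⟨P, rfl⟩ := hf r
  induction P using MvPolynomial.induction_on' with
  | add P Q hP hQ => rw [map_add, map_add]; exact add_mem hP hQ
  | monomial u a =>
    set x : Fin n → R := fun i => f (MvPolynomial.X i)
    have hmon : f (MvPolynomial.monomial u a) =
        (∏ i, x i ^ (u i / p ^ e)) ^ p ^ e * (a • ∏ i, x i ^ (u i % p ^ e)) := by
      rw [MvPolynomial.monomial_eq, Finsupp.prod_fintype _ _ (fun i => pow_zero _), map_mul,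
        map_prod, mul_smul_comm, ← Finset.prod_pow, ← Finset.prod_mul_distrib,
        MvPolynomial.algHom_C, Algebra.smul_def]
      congr 1
      refine Finset.prod_congr rfl fun i _ => ?_
      rw [map_pow, ← pow_mul, ← pow_add, Nat.div_add_mod']
    rw [hmon, ← FrobPush.smul_of]
    refine Submodule.smul_mem _ _ (Submodule.subset_span ⟨_, ?_, rfl⟩)
    refine Submodule.smul_mem _ _ (degLE_mono ?_
      (prod_mem_degLE Finset.univ fun i _ => pow_mem_degLE (hδ (x i)) (u i % p ^ e)))
    rw [Finset.sum_mul]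
    refine Finset.sum_le_sum fun i _ => ?_
    rw [mul_comm]
    exact Nat.mul_le_mul_left _ (Nat.mod_lt _ (by positivity)).le

theorem exists_frobPushIdeal_pow_le_span [Algebra.FiniteType K R] (hp : 0 < p) {I : Ideal R}
    (hI : I.FG) : ∃ c d : ℕ, ∀ e n : ℕ, frobPushIdeal p e (I ^ n) ≤
      Submodule.span R (FrobPush.of p e '' {x | x ∈ I ^ n ∧ x ∈ degLE 𝒜 (c * p ^ e + d * n)}) := by
  obtain ⟨c, hc⟩ := exists_span_degLE_eq_top 𝒜 p hp
  obtain ⟨d, hd⟩ := hI.exists_pow_le_span_degLE 𝒜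
  refine ⟨c, d, fun e n x hx => ?_⟩
  obtain ⟨f, rfl⟩ := (FrobPush.of p e).surjective x
  set N := Submodule.span R
    (FrobPush.of p e '' {x | x ∈ I ^ n ∧ x ∈ degLE 𝒜 (c * p ^ e + d * n)}) with hN
  have key : ∀ g ∈ Ideal.span {x | x ∈ I ^ n ∧ x ∈ degLE 𝒜 (d * n)}, ∀ r : R,
      FrobPush.of p e (r * g) ∈ N := by
    intro g hg
    induction hg using Submodule.span_induction with
    | mem h hh =>
      intro r
      have h1 : (⊤ : Submodule R (FrobPush R p e)) ≤ N.comap (FrobPush.mulEnd e h) := by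
        rw [← hc e, Submodule.span_le]
        rintro _ ⟨s, hs, rfl⟩
        refine Submodule.subset_span ⟨h * s, ⟨Ideal.mul_mem_right _ _ hh.1, ?_⟩, rfl⟩
        rw [mul_comm h]
        exact mul_mem_degLE hs hh.2
      rw [mul_comm]
      exact h1 (Submodule.mem_top (x := FrobPush.of p e r))
    | zero =>
      intro r
      rw [mul_zero, map_zero]
      exact zero_mem _
    | add y z _ _ hy hz =>
      intro r
      rw [mul_add, map_add]
      exact add_mem (hy r) (hz r)
    | smul s y _ hy =>
      intro r
      rw [smul_eq_mul, ← mul_assoc]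
      exact hy _
  simpa using key f (hd n ((of_mem_frobPushIdeal p).1 hx)) 1

end FrobeniusGeneration

/-! ### Finite-dimensionality of bounded degrees in a graded module. -/

section FiniteDimensional

/-- By the modular law, an independent family has no smaller family with supremum `⊤`. It serves to
recognize each graded piece from explicit spanning elements. -/
theorem iSupIndep.eq_of_le_of_iSup_eq_top {ι α : Type*} [CompleteLattice α] [IsModularLattice α]
    {f g : ι → α} (hf : iSupIndep f) (h : g ≤ f) (hg : ⨆ i, g i = ⊤) : g = f := by
  funext i
  refine le_antisymm (h i) ?_
  have h1 : g i ⊔ ⨆ (j) (_ : j ≠ i), g j = ⊤ := by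
    rw [eq_top_iff, ← hg]
    refine iSup_le fun j => ?_
    by_cases hj : j = i
    · exact hj ▸ le_sup_left
    · exact (le_iSup₂ (f := fun j (_ : j ≠ i) => g j) j hj).trans le_sup_right
  have h2 : (⨆ (j) (_ : j ≠ i), g j) ⊓ f i = ⊥ :=
    eq_bot_iff.2 ((inf_le_inf_right _ (iSup₂_mono fun j _ => h j)).trans
      (hf i).symm.le_bot)
  have h3 := sup_inf_assoc_of_le (⨆ (j) (_ : j ≠ i), g j) (h i)
  rw [h1, h2, top_inf_eq, sup_bot_eq] at h3
  exact h3.le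

variable {K R : Type*} [Field K] [CommRing R] [Algebra K R] (𝒜 : ℕ → Submodule K R)
  [GradedAlgebra 𝒜]

theorem exists_finset_adjoin_eq_top [Algebra.FiniteType K R]
    (h_zero : Function.Surjective (algebraMap K (𝒜 0))) :
    ∃ s : Finset R, Algebra.adjoin K (s : Set R) = ⊤ ∧ ∀ x ∈ s, ∃ n ≠ 0, x ∈ 𝒜 n := by
  have : IsScalarTower K (𝒜 0) R := ⟨fun k a r => smul_mul_assoc k (a : R) r⟩
  have : Algebra.FiniteType (𝒜 0) R := Algebra.FiniteType.of_restrictScalars_finiteType K (𝒜 0) R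
  obtain ⟨s, hs, hdeg⟩ := GradedAlgebra.exists_finset_adjoin_eq_top_and_homogeneous_ne_zero 𝒜
  refine ⟨s, ?_, hdeg⟩
  rw [eq_top_iff]
  rintro x -
  have hx : x ∈ Algebra.adjoin (𝒜 0) (s : Set R) := hs ▸ Algebra.mem_top
  induction hx using Algebra.adjoin_induction with
  | mem x hx => exact Algebra.subset_adjoin hx
  | algebraMap r =>
    obtain ⟨k, rfl⟩ := h_zero r
    exact Subalgebra.algebraMap_mem (Algebra.adjoin K (s : Set R)) k
  | add x y _ _ hx hy => exact add_mem hx hy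
  | mul x y _ _ hx hy => exact mul_mem hx hy

variable {𝒜} {M : Type*} [AddCommGroup M] [Module R M] [Module K M] [IsScalarTower K R M]
  {ℳ : ℚ → AddSubgroup M}

omit [GradedAlgebra 𝒜] [Module K M] [IsScalarTower K R M] in
theorem IsGradedModule.exists_finite_span [Module.Finite R M] (hM : IsGradedModule 𝒜 ℳ) :
    ∃ t : Finset M, (∀ x ∈ t, ∃ q, x ∈ ℳ q) ∧ Submodule.span R (t : Set M) = ⊤ := by
  have htop : Submodule.span R {x | ∃ q, x ∈ ℳ q} = ⊤ := by
    rw [eq_top_iff]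
    intro x _
    obtain ⟨y, rfl⟩ := hM.isInternal.2 x
    induction y using DirectSum.induction_on with
    | zero => rw [map_zero]; exact zero_mem _
    | of q x =>
      rw [DirectSum.coeAddMonoidHom_of]
      exact Submodule.subset_span ⟨q, x.2⟩
    | add x y hx hy => rw [map_add]; exact add_mem (hx trivial) (hy trivial)
  obtain ⟨t, ht, h⟩ := (Submodule.fg_span_iff_fg_span_finset_subset _).1
    (htop ▸ Module.Finite.fg_top (R := R) (M := M))
  exact ⟨t, fun x hx => ht hx, by rw [← h, htop]⟩

/-- Since `R_0 = K`, the algebra generators can be taken of positive degree, so only finitely many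
products of a monomial with a module generator have degree at most `D`. -/
theorem IsGradedModule.exists_finiteDimensional [Algebra.FiniteType K R] [Module.Finite R M]
    (h_zero : Function.Surjective (algebraMap K (𝒜 0))) (hM : IsGradedModule 𝒜 ℳ) (D : ℚ) :
    ∃ V : Submodule K M, FiniteDimensional K V ∧ ∀ q ≤ D, ∀ x ∈ ℳ q, x ∈ V := by
  classical
  obtain ⟨s, hs, hdeg⟩ := exists_finset_adjoin_eq_top 𝒜 h_zero
  obtain ⟨t, ht, hspan⟩ := hM.exists_finite_span
  choose! d hd0 hd using hdeg
  choose! β hβ using ht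
  let wt : (s →₀ ℕ) → ℕ := fun u => ∑ i, u i * d i
  let mon : (s →₀ ℕ) → R := fun u => ∏ i : s, (i : R) ^ u i
  have hmon : ∀ u, mon u ∈ 𝒜 (wt u) := fun u =>
    SetLike.prod_mem_graded _ _ _ fun i _ => by
      simpa using SetLike.pow_mem_graded (u i) (hd i i.2)
  -- `N q` is the visible part of degree `q`. The pieces `N q` lie in `ℳ q` and together exhaust
  -- `M`, hence `N = ℳ`.
  let N : ℚ → AddSubgroup M := fun q =>
    (Submodule.span K {x | ∃ u, ∃ b ∈ t, (wt u : ℚ) + β b = q ∧ x = mon u • b}).toAddSubgroup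
  have hsub : ∀ q, ∀ k : K, ∀ x ∈ ℳ q, k • x ∈ ℳ q := fun q k x hx => by
    have := hM.smul_mem 0 q (algebraMap K R k) x (SetLike.algebraMap_mem_graded 𝒜 k) hx
    rwa [algebraMap_smul, Nat.cast_zero, zero_add] at this
  have hle : N ≤ ℳ := by
    intro q x hx
    change x ∈ Submodule.span K _ at hx
    induction hx using Submodule.span_induction with
    | mem x hx =>
      obtain ⟨u, b, hb, rfl, rfl⟩ := hx
      exact hM.smul_mem _ _ _ _ (hmon u) (hβ b hb)
    | zero => exact zero_mem _
    | add x y _ _ hx hy => exact add_mem hx hy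
    | smul k x _ hx => exact hsub q k x hx
  have htop : ⨆ q, N q = ⊤ := by
    rw [eq_top_iff]
    intro x _
    have hx : x ∈ Submodule.span R (t : Set M) := hspan ▸ Submodule.mem_top
    suffices ∀ r : R, r • x ∈ ⨆ q, N q by simpa using this 1
    clear * - hx hs
    induction hx using Submodule.span_induction with
    | mem b hb =>
      intro r
      have hr : r ∈ Algebra.adjoin K (s : Set R) := hs ▸ Algebra.mem_top
      have hs' : (s : Set R) = Set.range ((↑) : s → R) := by simp
      rw [hs', Algebra.adjoin_range_eq_range_aeval] at hr
      obtain ⟨P, rfl⟩ := hr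
      induction P using MvPolynomial.induction_on' with
      | add P Q hP hQ =>
        change (MvPolynomial.aeval _ (P + Q)) • b ∈ _
        rw [map_add, add_smul]
        exact add_mem hP hQ
      | monomial u a =>
        refine AddSubgroup.mem_iSup_of_mem ((wt u : ℚ) + β b) ?_
        change (MvPolynomial.aeval _ (MvPolynomial.monomial u a)) • b ∈ _
        rw [MvPolynomial.aeval_monomial, Finsupp.prod_fintype _ _ (fun i => pow_zero _),
          ← Algebra.smul_def, smul_assoc]
        exact Submodule.smul_mem _ _ (Submodule.subset_span ⟨u, b, hb, rfl, rfl⟩)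
    | zero => intro r; rw [smul_zero]; exact zero_mem _
    | add x y _ _ hx hy => intro r; rw [smul_add]; exact add_mem (hx r) (hy r)
    | smul r' x _ hx => intro r; rw [smul_smul]; exact hx _
  have heq := (DirectSum.IsInternal.addSubgroup_iSupIndep hM.isInternal).eq_of_le_of_iSup_eq_top hle htop
  let T : Set M := ⋃ b ∈ t, (fun u => mon u • b) '' {u | (wt u : ℚ) + β b ≤ D}
  have hT : T.Finite := by
    refine t.finite_toSet.biUnion fun b _ => Set.Finite.image _ ?_
    refine (Set.finite_Iic (Finsupp.equivFunOnFinite.symm fun _ : s => ⌈D - β b⌉₊)).subset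
      fun u hu i => ?_
    have h1 : wt u ≤ ⌈D - β b⌉₊ := by
      have : (wt u : ℚ) ≤ (⌈D - β b⌉₊ : ℚ) := (le_sub_iff_add_le.2 hu).trans (Nat.le_ceil _)
      exact_mod_cast this
    calc u i ≤ u i * d i := Nat.le_mul_of_pos_right _ (Nat.pos_of_ne_zero (hd0 i i.2))
      _ ≤ wt u := Finset.single_le_sum (f := fun i : s => u i * d i)
        (fun _ _ => Nat.zero_le _) (Finset.mem_univ i)
      _ ≤ _ := h1
  refine ⟨Submodule.span K T, FiniteDimensional.span_of_finite K hT, fun q hq x hx => ?_⟩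
  rw [← heq] at hx
  refine Submodule.span_mono ?_ hx
  rintro _ ⟨u, b, hb, rfl, rfl⟩
  exact Set.mem_biUnion hb ⟨u, hq, rfl⟩

end FiniteDimensional

/-! ### Jumps of the chain `D^e · I^n`. -/

section Jumps

variable {R : Type u} [CommRing R] (p : ℕ) [ExpChar R p]

/-- The exponents `n` with `D^e · I ^ (n + 1) ≠ D^e · I ^ n`. -/
def diffJumps (I : Ideal R) (e : ℕ) : Set ℕ :=
  {n | ¬ frobPushIdeal p e (I ^ n) ≤ diffSpan p e (I ^ (n + 1))}

variable {p}

theorem mem_diffJumps_of_frobPower {I J : Ideal R} {e e' n : ℕ} (h : e ≤ e')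
    (h1 : ¬ I ^ n ≤ frobPower p e' J) (h2 : I ^ (n + 1) ≤ frobPower p e' J) :
    n ∈ diffJumps p I e := fun hn =>
  h1 fun _ hf => (hn.trans (diffSpan_le_of_le_frobPower h h2)) ((of_mem_frobPushIdeal p).2 hf)

theorem mem_diffJumps_of_cartierIdeal {I J : Ideal R} {e e' n : ℕ} (h : e ≤ e')
    (h1 : ¬ cartierIdeal p e' (I ^ n) ≤ J) (h2 : cartierIdeal p e' (I ^ (n + 1)) ≤ J) :
    n ∈ diffJumps p I e := fun hn =>
  h1 (cartierIdeal_le_of_le_diffSpan h hn h2)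

/-- If `I^(n - p^e)` lay in the `D^e`-span of the next power, multiplying by `I` on `F^e_* R`, which
acts through `I^{[p^e]} ⊆ I^(p^e)`, would carry the inclusion up to exponent `n`. -/
theorem sub_mem_diffJumps {I : Ideal R} {e n : ℕ} (hn : n ∈ diffJumps p I e) (hle : p ^ e ≤ n)
    (h : I ^ n ≤ frobPower p e I * I ^ (n - p ^ e)) : n - p ^ e ∈ diffJumps p I e := by
  intro hcon
  refine hn ((frobPushIdeal_mono p e h).trans ((frobPushIdeal_frobPower_mul_le p e _ _).trans
    ((Submodule.smul_mono le_rfl hcon).trans ((smul_diffSpan_le e _ _).trans (diffSpan_mono ?_)))))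
  refine (Ideal.mul_mono_left (frobPower_le_pow e I)).trans ?_
  rw [← pow_add]
  exact Ideal.pow_le_pow_right (by omega)

end Jumps

/-! ### Uniform bound on the number of jumps from finite `F`-representation type. -/

section Bound

variable {K : Type*} {R : Type u} [Field K] [CommRing R] [Algebra K R] [Algebra.FiniteType K R]
  {p : ℕ} [ExpChar R p] {𝒜 : ℕ → Submodule K R} [GradedAlgebra 𝒜]

theorem HasFFRT.exists_card_diffJumps_le (hp : 0 < p)
    (h_zero : Function.Surjective (algebraMap K (𝒜 0))) (h : HasFFRT p 𝒜) {I : Ideal R}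
    (hI : I.FG) (A : ℕ) : ∃ C : ℕ, ∀ (e : ℕ) (S : Finset ℕ), (S : Set ℕ) ⊆ diffJumps p I e →
      (∀ n ∈ S, n < A * p ^ e) → S.card ≤ C := by
  classical
  obtain ⟨l, M, _, _, ℳ, hfin, hgr, hdec⟩ := h
  obtain ⟨c, d, hcd⟩ := exists_frobPushIdeal_pow_le_span 𝒜 p hp hI
  let _ : ∀ i, Module K (M i) := fun i => Module.compHom (M i) (algebraMap K R)
  have : ∀ i, IsScalarTower K R (M i) := fun i =>
    ⟨fun k r m => by
      rw [Algebra.smul_def, mul_smul]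
      rfl⟩
  -- For `n < A * p ^ e`, degree at most `c * p ^ e + d * n` in `R` becomes degree at most `c + d *
  -- A` in `F^e_* R`. The spaces `V i` are therefore chosen before `e`.
  choose V hV hVmem using fun i => (hgr i).exists_finiteDimensional h_zero ((c + d * A : ℕ) : ℚ)
  refine ⟨∑ i, Module.finrank K (V i), fun e S hS hlt => ?_⟩
  obtain ⟨α, θ, hθ, Φ, hΦ⟩ := hdec e
  let π : ∀ i, Fin (α i) → FrobPush R p e →ₗ[R] M i := fun i j =>
    LinearMap.proj j ∘ₗ LinearMap.proj i ∘ₗ Φ.toLinearMap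
  let ι : ∀ i, Fin (α i) → M i →ₗ[R] FrobPush R p e := fun i j =>
    Φ.symm.toLinearMap ∘ₗ LinearMap.single R (fun i => Fin (α i) → M i) i ∘ₗ
      LinearMap.single R (fun _ => M i) j
  -- Since `ι i j ∘ π i j'` lies in `D^e`, the copies of `M i` are interchangeable for a
  -- `D^e`-submodule, and one submodule `P n i` serves all `j`.
  let P : ℕ → ∀ i, Submodule R (M i) := fun n i => ⨆ j, (frobPushIdeal p e (I ^ n)).map (π i j)
  have hP : ∀ i, Antitone fun n => P n i := fun i m n hmn =>
    iSup_mono fun j => Submodule.map_mono (frobPushIdeal_mono p e (Ideal.pow_le_pow_right hmn))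
  let W : ℕ → ∀ i, Submodule K (M i) := fun n i => (P n i).restrictScalars K ⊓ V i
  have hW : ∀ i, Antitone fun n => W n i := fun i m n hmn =>
    inf_le_inf_right _ (hP i hmn)
  have : ∀ n i, FiniteDimensional K (W n i) := fun n i =>
    Submodule.finiteDimensional_of_le (inf_le_right : W n i ≤ V i)
  have hanti : Antitone fun n => ∑ i, Module.finrank K (W n i) := fun m n hmn =>
    Finset.sum_le_sum fun i _ => Submodule.finrank_mono (hW i hmn)
  refine (card_le_of_forall_succ_lt hanti S fun n hn => ?_).trans
    (Finset.sum_le_sum fun i _ => Submodule.finrank_mono inf_le_right)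
  -- If no dimension drops, the traces `W` agree at `n` and `n + 1`. As `P n i` is generated by
  -- elements of `V i`, this forces `P n i ≤ P (n + 1) i`, so `n` is not a jump.
  by_contra hcon
  have hrank := (Finset.sum_eq_sum_iff_of_le (fun i _ =>
    Submodule.finrank_mono (hW i n.le_succ))).1 ((hanti n.le_succ).antisymm (not_lt.1 hcon))
  have hWeq : ∀ i, W (n + 1) i = W n i := fun i =>
    Submodule.eq_of_le_of_finrank_eq (hW i n.le_succ) (hrank i (Finset.mem_univ i))
  -- low degree elements are sent into `V`
  have hdeg : ∀ f ∈ degLE 𝒜 (c * p ^ e + d * n), ∀ i j, π i j (FrobPush.of p e f) ∈ V i := by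
    intro f hf i j
    refine degLE_le_of_forall (G := (V i).toAddSubgroup.comap
      ((π i j).toAddMonoidHom.comp (FrobPush.of p e).toAddMonoidHom)) (fun m hm x hx => ?_) hf
    have hpe : (0 : ℚ) < (p : ℚ) ^ e := by positivity
    have h1 := (hΦ ((m : ℚ) / (p : ℚ) ^ e) (FrobPush.of p e x)).1
      (Or.inr ⟨m, by field_simp, x, hx, rfl⟩) i j
    -- The component has degree `m / p ^ e + θ i j` in `M i`; the sign `θ i j ≤ 0` keeps it under
    -- the bound uniformly in `e`.
    refine hVmem i _ ?_ _ h1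
    have h2 : (m : ℚ) / (p : ℚ) ^ e ≤ ((c + d * A : ℕ) : ℚ) := by
      rw [div_le_iff₀ hpe]
      have h3 : m ≤ (c + d * A) * p ^ e := by
        have := Nat.mul_le_mul_left d (hlt n hn).le
        rw [add_mul, mul_assoc]
        omega
      exact_mod_cast h3
    linarith [hθ i j]
  have hPle : ∀ i, P n i ≤ P (n + 1) i := by
    intro i
    refine iSup_le fun j => ?_
    refine (Submodule.map_mono (hcd e n)).trans ?_
    rw [Submodule.map_span, Submodule.span_le]
    rintro _ ⟨_, ⟨f, ⟨hf, hf'⟩, rfl⟩, rfl⟩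
    have h1 : π i j (FrobPush.of p e f) ∈ W n i :=
      ⟨Submodule.mem_iSup_of_mem j (Submodule.mem_map_of_mem hf), hdeg f hf' i j⟩
    rw [← hWeq] at h1
    exact h1.1
  refine hS hn fun x hx => ?_
  have hι : ∀ i j, P (n + 1) i ≤ (diffSpan p e (I ^ (n + 1))).comap (ι i j) := by
    intro i j
    refine iSup_le fun j' => ?_
    rintro _ ⟨y, hy, rfl⟩
    exact apply_mem_diffSpan (ι i j ∘ₗ π i j') hy
  have hx' : x = ∑ i, ∑ j, ι i j (π i j x) := by
    apply Φ.injective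
    have h1 : ∀ i j, Φ (ι i j (π i j x)) = Pi.single i (Pi.single j (Φ x i j)) := fun i j =>
      Φ.apply_symm_apply _
    simp only [map_sum, h1]
    conv_lhs => rw [← Finset.univ_sum_single (Φ x)]
    refine Finset.sum_congr rfl fun i _ => ?_
    conv_lhs => rw [← Finset.univ_sum_single (Φ x i)]
    exact map_sum (LinearMap.single R (fun i => Fin (α i) → M i) i) _ _
  rw [hx']
  exact sum_mem fun i _ => sum_mem fun j _ =>
    hι i j (hPle i (Submodule.mem_iSup_of_mem j (Submodule.mem_map_of_mem hx)))

end Bound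

/-! ### Existence of the maxima and limits, and their terms as jumps. -/

section Existence

variable {R : Type u} [CommRing R] {p : ℕ} [ExpChar R p]

theorem Ideal.exists_pow_le_frobPower_mul {I : Ideal R} (hI : I.FG) :
    ∃ μ : ℕ, 0 < μ ∧ (∀ e n, μ * p ^ e ≤ n → I ^ n ≤ frobPower p e I * I ^ (n - p ^ e)) ∧
      ∀ e m n, (μ + m) * p ^ e ≤ n → I ^ n ≤ frobPower p e (I ^ m) := by
  obtain ⟨μ, hμ, h⟩ := Ideal.exists_pow_le_span_pow_mul hI
  have h' : ∀ e n, μ * p ^ e ≤ n → I ^ n ≤ frobPower p e I * I ^ (n - p ^ e) :=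
    fun e n => h (p ^ e) n
  refine ⟨μ, hμ, h', fun e m => ?_⟩
  simp only [← frobPower_pow]
  induction m with
  | zero => simp
  | succ m ih =>
    intro n hn
    rw [pow_succ']
    have h1 : (μ + (m + 1)) * p ^ e = (μ + m) * p ^ e + p ^ e := by ring
    have h2 : (μ + m) * p ^ e = μ * p ^ e + m * p ^ e := by ring
    exact (h' e n (by omega)).trans (Ideal.mul_mono_right (ih _ (by omega)))

theorem exists_isFThreshold (hp : 2 ≤ p) {I J : Ideal R} (hI : I.FG) (hIJ : I ≤ J.radical)
    (hJ : J ≠ ⊤) : ∃ c : ℝ, IsFThreshold p I J c := by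
  obtain ⟨N, hN⟩ := Ideal.exists_pow_le_of_le_radical_of_fg hIJ hI
  obtain ⟨μ, hμ, -, hpow⟩ := Ideal.exists_pow_le_frobPower_mul (p := p) hI
  have hex : ∀ e, ∃ m, IsGreatest {n : ℕ | ¬ I ^ n ≤ frobPower p e J} m := fun e => by
    refine BddAbove.exists_isGreatest_of_nonempty ⟨(μ + N) * p ^ e, fun n hn => ?_⟩ ⟨0, ?_⟩
    · by_contra hlt
      exact hn ((hpow e N n (by omega)).trans (frobPower_mono p e hN))
    · rw [Set.mem_ofPred_eq, pow_zero, Ideal.one_eq_top, top_le_iff]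
      exact fun h => hJ (top_le_iff.1 (h ▸ frobPower_le_self (by omega) e J))
  choose ν hν using hex
  -- Applying Frobenius to `I ^ (ν e + 1) ≤ J^{[p^e]}` places all powers of `I` from `(μ + ν e + 1)
  -- * p` on inside `J^{[p^(e+1)]}`, whence `B = μ + 1`.
  obtain ⟨c, hc⟩ := exists_tendsto_div_pow_of_le (p := p) (B := μ + 1) (ν := ν) hp fun e => by
    have h1 : I ^ (ν e + 1) ≤ frobPower p e J := by
      by_contra hcon
      exact absurd ((hν e).2 hcon) (by omega)
    by_contra hlt
    refine (hν (e + 1)).1 ((hpow 1 (ν e + 1) _ ?_).trans ?_)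
    · rw [pow_one, mul_comm, show μ + (ν e + 1) = ν e + (μ + 1) by ring]
      omega
    · rw [← frobPower_frobPower]
      exact frobPower_mono p 1 h1
  exact ⟨c, ν, hν, hc⟩

theorem IsFSplit.exists_isCartierThreshold (hp : 2 ≤ p) (hR : IsFSplit R p) {I J : Ideal R}
    (hI : I.FG) (hIJ : I ≤ J.radical) (hJ : J ≠ ⊤) : ∃ c : ℝ, IsCartierThreshold p I J c := by
  obtain ⟨N, hN⟩ := Ideal.exists_pow_le_of_le_radical_of_fg hIJ hI
  obtain ⟨μ, hμ, -, hpow⟩ := Ideal.exists_pow_le_frobPower_mul (p := p) hI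
  have hbdd : ∀ e n, ¬ cartierIdeal p e (I ^ n) ≤ J → n ≤ (μ + N) * p ^ e := fun e n hn => by
    by_contra hlt
    refine hn ((cartierIdeal_mono ?_).trans (cartierIdeal_frobPower_mul_le e J ⊤))
    rw [Ideal.mul_top]
    exact (hpow e N n (by omega)).trans (frobPower_mono p e hN)
  have hex : ∀ e, ∃ m, IsGreatest {n : ℕ | ¬ cartierIdeal p e (I ^ n) ≤ J} m := fun e => by
    refine BddAbove.exists_isGreatest_of_nonempty ⟨(μ + N) * p ^ e, hbdd e⟩ ⟨0, ?_⟩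
    rw [Set.mem_ofPred_eq, pow_zero, Ideal.one_eq_top, hR.cartierIdeal_top, top_le_iff]
    exact hJ
  choose ν hν using hex
  obtain ⟨c, hc⟩ := exists_tendsto_div_pow_of_ge (p := p) (B := μ + N) (ν := ν) (by omega)
    (fun e => (hν (e + 1)).2 fun h => (hν e).1 (hR.cartierIdeal_le_succ h))
    (fun e => hbdd e _ (hν e).1)
  exact ⟨c, ν, hν, hc⟩

theorem IsFThreshold.exists_mem_diffJumps {I J : Ideal R} {c : ℝ} (h : IsFThreshold p I J c) :
    ∃ ν : ℕ → ℕ, (∀ e e', e ≤ e' → ν e' ∈ diffJumps p I e) ∧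
      Tendsto (fun e => (ν e : ℝ) / (p : ℝ) ^ e) atTop (𝓝 c) := by
  obtain ⟨ν, hν, hc⟩ := h
  refine ⟨ν, fun e e' hee' => mem_diffJumps_of_frobPower hee' (hν e').1 ?_, hc⟩
  by_contra hcon
  exact absurd ((hν e').2 hcon) (by omega)

theorem IsCartierThreshold.exists_mem_diffJumps {I J : Ideal R} {c : ℝ}
    (h : IsCartierThreshold p I J c) :
    ∃ ν : ℕ → ℕ, (∀ e e', e ≤ e' → ν e' ∈ diffJumps p I e) ∧
      Tendsto (fun e => (ν e : ℝ) / (p : ℝ) ^ e) atTop (𝓝 c) := by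
  obtain ⟨ν, hν, hc⟩ := h
  refine ⟨ν, fun e e' hee' => mem_diffJumps_of_cartierIdeal hee' (hν e').1 ?_, hc⟩
  by_contra hcon
  exact absurd ((hν e').2 hcon) (by omega)

end Existence

/-! ### Assembly of the two statements. -/

theorem mainTheorem9 {K : Type*} {R : Type u} [Field K] [CommRing R] [Algebra K R]
    [Algebra.FiniteType K R] (p : ℕ) [Fact p.Prime] [CharP R p]
    (𝒜 : ℕ → Submodule K R) [GradedAlgebra 𝒜]
    (h_zero : Function.Bijective (algebraMap K (𝒜 0)))
    (h_ffrt : HasFFRT p 𝒜) (𝔞 : Ideal R) :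
    ((∀ 𝔟 : Ideal R, 𝔞 ≤ 𝔟.radical → 𝔟.radical ≠ ⊤ → ∃ c : ℝ, IsFThreshold p 𝔞 𝔟 c) ∧
      (∀ c ∈ fThresholds p 𝔞, ∃ q : ℚ, (q : ℝ) = c) ∧
      (∀ x : ℝ, ¬ AccPt x (𝓟 (fThresholds p 𝔞)))) ∧
    (IsFSplit R p →
      (∀ 𝔟 : Ideal R, 𝔞 ≤ 𝔟.radical → 𝔟.radical ≠ ⊤ → ∃ c : ℝ, IsCartierThreshold p 𝔞 𝔟 c) ∧
      (∀ c ∈ cartierThresholds p 𝔞, ∃ q : ℚ, (q : ℝ) = c) ∧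
      (∀ x : ℝ, ¬ AccPt x (𝓟 (cartierThresholds p 𝔞)))) := by
  have hp : 2 ≤ p := (Fact.out : p.Prime).two_le
  have : IsNoetherianRing R := Algebra.FiniteType.isNoetherianRing K R
  have hfg : 𝔞.FG := IsNoetherian.noetherian 𝔞
  have hne : ∀ 𝔟 : Ideal R, 𝔟.radical ≠ ⊤ → 𝔟 ≠ ⊤ :=
    fun 𝔟 h h' => h (by rw [h', Ideal.radical_top])
  have hcard := h_ffrt.exists_card_diffJumps_le (by omega) h_zero.2 hfg
  obtain ⟨μ, hμ, hskoda, -⟩ := Ideal.exists_pow_le_frobPower_mul (p := p) hfg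
  -- Rationality needs the count only below `μ * p ^ e`, from where on jumps can be lowered by `p ^
  -- e`; discreteness uses it for every `A`.
  obtain ⟨C, hC⟩ := hcard μ
  have hrat : ∀ c : ℝ, (∃ ν : ℕ → ℕ, (∀ e e', e ≤ e' → ν e' ∈ diffJumps p 𝔞 e) ∧
      Tendsto (fun e => (ν e : ℝ) / (p : ℝ) ^ e) atTop (𝓝 c)) → ∃ q : ℚ, (q : ℝ) = c := by
    rintro c ⟨ν, hν, hc⟩
    refine exists_rat_eq_of_card_le hp hC (fun e n hn hle => ?_) hν hc
    have hle' : p ^ e ≤ n := (Nat.le_mul_of_pos_left _ hμ).trans hle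
    exact ⟨hle', sub_mem_diffJumps hn hle' (hskoda e n hle)⟩
  have hacc : ∀ T : Set ℝ, (∀ c ∈ T, ∃ ν : ℕ → ℕ, (∀ e e', e ≤ e' → ν e' ∈ diffJumps p 𝔞 e) ∧
      Tendsto (fun e => (ν e : ℝ) / (p : ℝ) ^ e) atTop (𝓝 c)) → ∀ x : ℝ, ¬ AccPt x (𝓟 T) :=
    fun T hT => not_accPt_of_finite_inter_Iio (finite_inter_Iio_of_card_le (by omega) hcard
      fun c hc => (hT c hc).imp fun ν hν => ⟨fun e => hν.1 e e le_rfl, hν.2⟩)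
  have hF : ∀ c ∈ fThresholds p 𝔞, ∃ ν : ℕ → ℕ, (∀ e e', e ≤ e' → ν e' ∈ diffJumps p 𝔞 e) ∧
      Tendsto (fun e => (ν e : ℝ) / (p : ℝ) ^ e) atTop (𝓝 c) :=
    fun c ⟨_, _, _, hc⟩ => hc.exists_mem_diffJumps
  have hct : ∀ c ∈ cartierThresholds p 𝔞, ∃ ν : ℕ → ℕ,
      (∀ e e', e ≤ e' → ν e' ∈ diffJumps p 𝔞 e) ∧
      Tendsto (fun e => (ν e : ℝ) / (p : ℝ) ^ e) atTop (𝓝 c) :=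
    fun c ⟨_, _, _, hc⟩ => hc.exists_mem_diffJumps
  exact ⟨⟨fun 𝔟 h1 h2 => exists_isFThreshold hp hfg h1 (hne 𝔟 h2),
      fun c hc => hrat c (hF c hc), hacc _ hF⟩,
    fun hsplit => ⟨fun 𝔟 h1 h2 => hsplit.exists_isCartierThreshold hp hfg h1 (hne 𝔟 h2),
      fun c hc => hrat c (hct c hc), hacc _ hct⟩⟩
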